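/- For topological spaces $Z,Y$ say that $Z\times Y$ has UU (the uniquely universal property) if there is an open set $U\subseteq Z\times Y$ such that for every open $W\subseteq Y$ there is exactly one $z\in Z$ with $U_z=\{y\in Y:(z,y)\in U\}=W$; such a $U$ is said to witness UU for $Z\times Y$. Here $\omega^\omega$ is Baire space. Let $X$ be a countable metric space that is not compact. Then: (1) $\omega^\omega\times X$ has UU. (2) $X$ has a countable basis $\mathcal B$ of open sets that contains $\emptyset$, is closed under finite unions, and is such that $X\setminus B$ is infinite for every $B\in\mathcal B$. (3) Let $\mathcal B$ be any basis as in (2). Let $\mathbb P$ be the set of pairs $p=(B_p,F_p)$ with $B_p\in\mathcal B$, $F_p\subseteq X$ finite and $B_p\cap F_p=\emptyset$, partially ordered by $p\le q$ iff $B_q\subseteq B_p$ and $F_q\subseteq F_p$; write $p\perp q$ if no $r\in\mathbb P$ satisfies $r\le p$ and $r\le q$. Call $G\subseteq\mathbb P$ a good filter if (i) $p\le q$ and $p\in G$ imply $q\in G$; (ii) for all $p,q\in G$ there is $r\in G$ with $r\le p$ and $r\le q$; (iii) for every $x\in X$ there is $p\in G$ with $x\in B_p\cup F_p$; (iv) for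 every $p\in\mathbb P$ either $p\in G$ or there is $q\in G$ with $p\perp q$. Let $\mathcal G$ be the set of good filters, with the subspace topology from $\mathcal P(\mathbb P)=2^{\mathbb P}$. Then $\mathbb P$ is countable; the maps $G\mapsto U_G=\bigcup\{B_p:p\in G\}$ and $U\mapsto G_U=\{p\in\mathbb P: B_p\subseteq U,\ F_p\cap U=\emptyset\}$ are mutually inverse bijections between $\mathcal G$ and the family of open subsets of $X$; the set $\{(G,x)\in\mathcal G\times X:\exists p\in G\ \ x\in B_p\}$ witnesses UU for $\mathcal G\times X$; and $\mathcal G$ is a zero-dimensional (i.e. it has a basis of clopen sets) Polish space without isolated points. In particular, $\omega^\omega\times\mathbb Q$ has UU. -/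

import Mathlib

/-- `U ⊆ X × Y` is uniquely universal for the open subsets of `Y`: it is open, and every open
`W ⊆ Y` is the section `U_x` for exactly one `x`. (Sections of an open set are open.) -/
def IsUniquelyUniversal {X Y : Type*} [TopologicalSpace X] [TopologicalSpace Y]
    (U : Set (X × Y)) : Prop :=
  IsOpen U ∧ ∀ W : Set Y, IsOpen W → ∃! x : X, {y : Y | (x, y) ∈ U} = W

/-- `X × Y` has the uniquely universal property. -/
def UU (X Y : Type*) [TopologicalSpace X] [TopologicalSpace Y] : Prop :=
  ∃ U : Set (X × Y), IsUniquelyUniversal U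

/-- A space is zero-dimensional if its clopen sets form a basis. -/
def IsZeroDimensional (X : Type*) [TopologicalSpace X] : Prop :=
  TopologicalSpace.IsTopologicalBasis {s : Set X | IsClopen s}

/-- Countable bases that contain the empty set, are closed under finite unions, and whose members
all have infinite complement. -/
structure IsCodingBasis {X : Type*} [TopologicalSpace X] (𝓑 : Set (Set X)) : Prop where
  isBasis : TopologicalSpace.IsTopologicalBasis 𝓑
  countable : 𝓑.Countable
  empty_mem : ∅ ∈ 𝓑
  union_mem : ∀ B ∈ 𝓑, ∀ C ∈ 𝓑, B ∪ C ∈ 𝓑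
  infinite_compl : ∀ B ∈ 𝓑, Bᶜ.Infinite

/-- The conditions `(B, F)`: `B ∈ 𝓑`, and `F` is a finite set disjoint from `B`. -/
@[ext]
structure Condition {X : Type*} (𝓑 : Set (Set X)) where
  B : Set X
  F : Finset X
  mem : B ∈ 𝓑
  disj : Disjoint B (F : Set X)

namespace Condition

variable {X : Type*} {𝓑 : Set (Set X)}

/-- `p ≤ q` iff `B_q ⊆ B_p` and `F_q ⊆ F_p`. -/
instance : PartialOrder (Condition 𝓑) where
  le p q := q.B ⊆ p.B ∧ q.F ⊆ p.F
  le_refl _ := ⟨subset_rfl, subset_rfl⟩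
  le_trans _ _ _ h₁ h₂ := ⟨h₂.1.trans h₁.1, h₂.2.trans h₁.2⟩
  le_antisymm _ _ h₁ h₂ :=
    Condition.ext (Set.Subset.antisymm h₂.1 h₁.1) (Finset.Subset.antisymm h₂.2 h₁.2)

/-- Two conditions are incompatible if they have no common lower bound. -/
def Incompatible (p q : Condition 𝓑) : Prop :=
  ¬ ∃ r : Condition 𝓑, r ≤ p ∧ r ≤ q

end Condition

/-- Good filters on the poset of conditions. -/
structure IsGoodFilter {X : Type*} {𝓑 : Set (Set X)} (G : Set (Condition 𝓑)) : Prop where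
  upward : ∀ p q, p ≤ q → p ∈ G → q ∈ G
  directed : ∀ p ∈ G, ∀ q ∈ G, ∃ r ∈ G, r ≤ p ∧ r ≤ q
  decides : ∀ x : X, ∃ p ∈ G, x ∈ p.B ∪ (p.F : Set X)
  mem_or_incompatible : ∀ p, p ∈ G ∨ ∃ q ∈ G, p.Incompatible q

/-- The type of good filters. -/
def GoodFilter {X : Type*} (𝓑 : Set (Set X)) : Type _ :=
  {G : Set (Condition 𝓑) // IsGoodFilter G}

namespace GoodFilter

variable {X : Type*} {𝓑 : Set (Set X)}

open Classical in
/-- The characteristic function of a good filter, a point of `2^ℙ`. -/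
noncomputable def char (G : GoodFilter 𝓑) : Condition 𝓑 → Bool :=
  fun p => decide (p ∈ G.1)

/-- The subspace topology from the power set of the poset, identified with `2^ℙ` (product
topology, discrete factors). -/
noncomputable instance : TopologicalSpace (GoodFilter 𝓑) :=
  TopologicalSpace.induced char inferInstance

/-- `U_G`, the union of the `B_p` with `p ∈ G`. -/
def openSet (G : GoodFilter 𝓑) : Set X :=
  ⋃ p ∈ G.1, p.B

end GoodFilter

/-- `G_U`, the set of conditions `p` with `B_p ⊆ U` and `F_p ∩ U = ∅`. -/
def codeSet {X : Type*} (𝓑 : Set (Set X)) (U : Set X) : Set (Condition 𝓑) :=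
  {p | p.B ⊆ U ∧ (p.F : Set X) ∩ U = ∅}

open Set Filter Topology TopologicalSpace

/-! An open `U` is coded by all finite-style promises "`B` inside, `F` outside" that it keeps.
Directedness and maximality (iv) make a good filter recoverable from the union of its `B`s
(`codeSet_openSet`), so good filters code the open sets bijectively, and membership is an open
relation. The filter axioms are Gδ conditions over countable index sets, which gives a Polish
topology (`isGδ_range_char`). The clopen sets `{G | p ∈ G}` form a basis
(`exists_mem_forall_of_mem_nhds`), and infinite complements leave room for two codes in each, so no
point is isolated. UU pulls back along continuous bijections, so it suffices to map Baire space
bijectively onto such a space (`exists_continuous_bijective_nat_nat`). A homeomorphism is too much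
to ask: the filter space can be a Cantor set, as for discrete `ℕ` with finite basic sets. The
bijection comes from a scheme that repeatedly splits a perfect set into infinitely many small
perfect sets (`Perfect.exists_small_partition`). -/

/-- A space that embeds as a `Gδ` set into a Polish space is Polish. -/
theorem Topology.IsEmbedding.polishSpace_of_isGδ_range {α β : Type*} [TopologicalSpace α]
    [TopologicalSpace β] [PolishSpace β] {f : α → β} (hf : IsEmbedding f)
    (hr : IsGδ (range f)) : PolishSpace α := by
  obtain ⟨U, hU, hr⟩ := isGδ_iff_eq_iInter_nat.1 hr
  have (i : ℕ) : PolishSpace (U i) := (hU i).polishSpace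
  have hm : ∀ x i, f x ∈ U i := fun x => mem_iInter.1 (hr ▸ mem_range_self x)
  have hc : Continuous f := hf.continuous
  -- Adding `f x` as a point of each `U i` makes the range closed: it is cut out by equality of
  -- coordinates.
  let g : α → β × (∀ i, U i) := fun x => (f x, fun i => ⟨f x, hm x i⟩)
  have hg : Continuous g := by fun_prop
  refine IsClosedEmbedding.polishSpace (f := g) ⟨IsEmbedding.of_comp hg continuous_fst hf, ?_⟩
  have : range g = ⋂ i, {z | (z.2 i : β) = z.1} := by
    ext ⟨y, z⟩
    simp only [mem_iInter, mem_range]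
    constructor
    · rintro ⟨x, hx⟩ i
      cases hx
      rfl
    · intro h
      change ∀ i, (z i : β) = y at h
      have : y ∈ range f := by
        rw [hr, mem_iInter]
        exact fun i => h i ▸ (z i).2
      obtain ⟨x, rfl⟩ := this
      exact ⟨x, Prod.ext rfl (funext fun i => Subtype.ext (h i).symm)⟩
  rw [this]
  exact isClosed_iInter fun i => isClosed_eq (by fun_prop) (by fun_prop)

/-! ### Perfect zero-dimensional Polish spaces as bijective images of Baire space -/

/-- A zero-dimensional second-countable metric space has countable clopen partitions into
arbitrarily small pieces. -/
theorem IsZeroDimensional.exists_small_clopen_partition {α : Type*} [PseudoEMetricSpace α]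
    [SecondCountableTopology α] [Nonempty α] (hz : IsZeroDimensional α) {ε : ENNReal}
    (hε : 0 < ε) :
    ∃ c : α → ℕ, ∀ k, IsClopen (c ⁻¹' {k}) ∧ ∃ z, c ⁻¹' {k} ⊆ Metric.eball z ε := by
  have h (x : α) : ∃ V : Set α, IsClopen V ∧ x ∈ V ∧ V ⊆ Metric.eball x ε :=
    hz.mem_nhds_iff.1 (Metric.eball_mem_nhds x hε)
  choose V hV hxV hVb using h
  obtain ⟨s, hs, hcov⟩ := TopologicalSpace.countable_cover_nhds
    fun x => (hV x).isOpen.mem_nhds (hxV x)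
  have hsne : s.Nonempty := by
    by_contra hne
    rw [not_nonempty_iff_eq_empty.1 hne, biUnion_empty] at hcov
    exact empty_ne_univ hcov
  obtain ⟨u, rfl⟩ := hs.exists_eq_range hsne
  have hex (y : α) : ∃ n, y ∈ V (u n) := by
    have : y ∈ ⋃ x ∈ range u, V x := hcov ▸ mem_univ y
    simpa using this
  classical
  refine ⟨fun y => Nat.find (hex y), fun k => ?_⟩
  have hk : (fun y => Nat.find (hex y)) ⁻¹' {k} = V (u k) ∩ ⋂ j ∈ Finset.range k, (V (u j))ᶜ := by
    ext y
    simp [Nat.find_eq_iff]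
  rw [hk]
  exact ⟨(hV _).inter (isClopen_biInter_finset fun j _ => (hV _).compl),
    u k, inter_subset_left.trans (hVb _)⟩

/-- A point of a perfect set has a decreasing neighbourhood basis of clopen sets whose consecutive
differences all meet the perfect set. -/
theorem Preperfect.exists_clopen_seq {α : Type*} [TopologicalSpace α] [T1Space α]
    [FirstCountableTopology α] (hz : IsZeroDimensional α) {A : Set α} (hA : Preperfect A)
    {x : α} (hx : x ∈ A) {O : Set α} (hO : O ∈ 𝓝 x) :
    ∃ V : ℕ → Set α, Antitone V ∧ V 0 = univ ∧ (∀ n, IsClopen (V n)) ∧ (∀ n, x ∈ V n) ∧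
      V 1 ⊆ O ∧ (∀ s ∈ 𝓝 x, ∃ n, V n ⊆ s) ∧ ∀ n, (A ∩ (V n \ V (n + 1))).Nonempty := by
  obtain ⟨W, hW⟩ := (𝓝 x).exists_antitone_basis
  have hstep (n : ℕ) (V : {V : Set α // IsClopen V ∧ x ∈ V}) :
      ∃ V' : {V : Set α // IsClopen V ∧ x ∈ V}, V'.1 ⊆ V.1 ∧ V'.1 ⊆ W n ∧ V'.1 ⊆ O ∧
        (A ∩ (V.1 \ V'.1)).Nonempty := by
    obtain ⟨V, hV, hxV⟩ := V
    -- The next set is shrunk to omit this `y`, so the difference meets `A`.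
    obtain ⟨y, ⟨hyV, hyA⟩, hyx⟩ := preperfect_iff_nhds.1 hA x hx V (hV.isOpen.mem_nhds hxV)
    have hn : V ∩ W n ∩ O ∩ {y}ᶜ ∈ 𝓝 x :=
      inter_mem (inter_mem (inter_mem (hV.isOpen.mem_nhds hxV) (hW.mem n)) hO)
        (isOpen_compl_singleton.mem_nhds hyx.symm)
    obtain ⟨V', hV', hxV', hsub⟩ := hz.mem_nhds_iff.1 hn
    exact ⟨⟨V', hV', hxV'⟩, fun z hz => (hsub hz).1.1.1, fun z hz => (hsub hz).1.1.2,
      fun z hz => (hsub hz).1.2, y, hyA, hyV, fun hy => (hsub hy).2 rfl⟩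
  choose next h₁ h₂ h₃ h₄ using hstep
  let V : ℕ → {V : Set α // IsClopen V ∧ x ∈ V} :=
    fun n => Nat.rec ⟨univ, isClopen_univ, mem_univ x⟩ next n
  refine ⟨fun n => (V n).1, antitone_nat_of_succ_le fun n => h₁ n (V n), rfl, fun n => (V n).2.1,
    fun n => (V n).2.2, h₃ 0 (V 0), fun s hs => ?_, fun n => h₄ n (V n)⟩
  obtain ⟨n, hn⟩ := hW.mem_iff.1 hs
  exact ⟨n + 1, (h₂ n (V n)).trans hn⟩

/-- A nonempty perfect set in a zero-dimensional second-countable metric space splits into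
infinitely many small nonempty perfect sets, here given as the fibres of a function. -/
theorem Perfect.exists_small_partition {α : Type*} [EMetricSpace α]
    [SecondCountableTopology α] (hz : IsZeroDimensional α) {A : Set α} (hA : Perfect A)
    (hne : A.Nonempty) {ε : ENNReal} (hε : 0 < ε) :
    ∃ g : α → ℕ, ∀ n, Perfect (A ∩ g ⁻¹' {n}) ∧ (A ∩ g ⁻¹' {n}).Nonempty ∧
      ∃ z, A ∩ g ⁻¹' {n} ⊆ Metric.eball z ε := by
  classical
  obtain ⟨x, hx⟩ := hne
  have : Nonempty α := ⟨x⟩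
  obtain ⟨c, hc⟩ := hz.exists_small_clopen_partition hε
  obtain ⟨V, hanti, hV0, hVc, hxV, hV1, hVb, hVA⟩ :=
    hA.acc.exists_clopen_seq hz hx (Metric.eball_mem_nhds x hε)
  have hD (n : ℕ) : IsClopen (V n \ V (n + 1)) := (hVc n).diff (hVc (n + 1))
  have huniq {y : α} {n m : ℕ} (hn : y ∈ V n \ V (n + 1)) (hm : y ∈ V m \ V (m + 1)) : n = m := by
    rcases lt_trichotomy n m with h | h | h
    · exact (hn.2 (hanti (Nat.succ_le_of_lt h) hm.1)).elim
    · exact h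
    · exact (hm.2 (hanti (Nat.succ_le_of_lt h) hn.1)).elim
  have hcover {y : α} (hy : y ≠ x) : ∃ n, y ∈ V n \ V (n + 1) := by
    obtain ⟨n, hn⟩ := hVb {y}ᶜ (isOpen_compl_singleton.mem_nhds hy.symm)
    have hex : ∃ n, y ∉ V n := ⟨n, fun h => hn h rfl⟩
    have hpos : Nat.find hex ≠ 0 := fun h0 => by
      have := Nat.find_spec hex
      rw [h0, hV0] at this
      exact this (mem_univ y)
    obtain ⟨m, hm⟩ := Nat.exists_eq_succ_of_ne_zero hpos
    refine ⟨m, not_not.1 (Nat.find_min hex (by omega)), ?_⟩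
    have := Nat.find_spec hex
    rwa [hm] at this
  -- Even shells around `x` are cut into small clopen pieces. The odd shells together with `x` form
  -- the single piece `none`, in which `x` is a limit of odd shells.
  let f : α → Option (ℕ × ℕ) := fun y =>
    if h : ∃ n, y ∈ V (2 * n) \ V (2 * n + 1) then some (h.choose, c y) else none
  have hsome (n k : ℕ) : f ⁻¹' {some (n, k)} = V (2 * n) \ V (2 * n + 1) ∩ c ⁻¹' {k} := by
    ext y
    simp only [mem_preimage, mem_singleton_iff, mem_inter_iff, f]
    split_ifs with h
    · have heq {m : ℕ} (hm : y ∈ V (2 * m) \ V (2 * m + 1)) : h.choose = m := by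
        have := huniq h.choose_spec hm
        omega
      constructor
      · intro h'
        simp only [Option.some.injEq, Prod.mk.injEq] at h'
        exact ⟨h'.1 ▸ h.choose_spec, h'.2⟩
      · rintro ⟨h1, h2⟩
        rw [heq h1, h2]
    · exact ⟨fun h' => by simp at h', fun h' => (h ⟨n, h'.1⟩).elim⟩
  have hnone : f ⁻¹' {none} = (⋃ n, V (2 * n) \ V (2 * n + 1))ᶜ := by
    ext y
    simp only [mem_preimage, mem_singleton_iff, mem_compl_iff, mem_iUnion, f]
    split_ifs with h
    · exact ⟨fun h' => h'.elim, fun h' => (h' h).elim⟩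
    · exact ⟨fun _ => h, fun _ => rfl⟩
  have hperfect (i : Option (ℕ × ℕ)) :
      Perfect (A ∩ f ⁻¹' {i}) ∧ ∃ z, A ∩ f ⁻¹' {i} ⊆ Metric.eball z ε := by
    rcases i with _ | ⟨n, k⟩
    · rw [hnone]
      refine ⟨⟨hA.closed.inter (isOpen_iUnion fun n => (hD _).isOpen).isClosed_compl, ?_⟩, x, ?_⟩
      · have hodd {n : ℕ} {y : α} (hy : y ∈ V (2 * n + 1) \ V (2 * n + 1 + 1)) :
            y ∈ (⋃ n, V (2 * n) \ V (2 * n + 1))ᶜ := by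
          rw [mem_compl_iff, mem_iUnion]
          rintro ⟨m, hm⟩
          have := huniq hy hm
          omega
        rw [preperfect_iff_nhds]
        rintro y ⟨hyA, hy⟩ s hs
        by_cases hyx : y = x
        · subst hyx
          obtain ⟨n, hn⟩ := hVb s hs
          obtain ⟨z, hzA, hz⟩ := hVA (2 * n + 1)
          exact ⟨z, ⟨hn (hanti (by omega) hz.1), hzA, hodd hz⟩,
            fun h => hz.2 (h ▸ hxV _)⟩
        · obtain ⟨n, hn⟩ := hcover hyx
          obtain ⟨m, rfl⟩ : ∃ m, n = 2 * m + 1 := by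
            rcases Nat.even_or_odd' n with ⟨m, rfl | rfl⟩
            · exact (hy (mem_iUnion.2 ⟨m, hn⟩)).elim
            · exact ⟨m, rfl⟩
          obtain ⟨z, ⟨⟨hzs, hzV⟩, hzA⟩, hzy⟩ := preperfect_iff_nhds.1 hA.acc y hyA _
            (inter_mem hs ((hD _).isOpen.mem_nhds hn))
          exact ⟨z, ⟨hzs, hzA, hodd hzV⟩, hzy⟩
      -- Shell `0` is even, so the piece `none` lies in `V 1`, hence in the ball.
      · rintro y ⟨-, hy⟩
        by_contra hyO
        refine hy (mem_iUnion.2 ⟨0, ?_, fun h => hyO (hV1 h)⟩)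
        simp [hV0]
    · rw [hsome]
      obtain ⟨hk, z, hz⟩ := hc k
      have ho : IsClopen (V (2 * n) \ V (2 * n + 1) ∩ c ⁻¹' {k}) := (hD _).inter hk
      refine ⟨⟨hA.closed.inter ho.isClosed, ?_⟩, z, fun y hy => hz hy.2.2⟩
      rw [inter_comm]
      exact hA.acc.open_inter ho.isOpen
  -- Some pieces may miss `A`; every even shell meets it, so infinitely many survive and can be
  -- renumbered by `ℕ`.
  have hinf : (f '' A).Infinite := by
    choose y hyA hy using fun n => hVA (2 * n)
    refine infinite_of_injective_forall_mem (f := fun n : ℕ => f (y n)) ?_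
      fun n => mem_image_of_mem f (hyA n)
    intro n m hnm
    have h (n : ℕ) : f (y n) = some (n, c (y n)) :=
      (hsome n (c (y n))).symm.subset ⟨hy n, rfl⟩
    simp only [h, Option.some.injEq, Prod.mk.injEq] at hnm
    exact hnm.1
  have := hinf.to_subtype
  obtain ⟨e⟩ := nonempty_equiv_of_countable (α := f '' A) (β := ℕ)
  refine ⟨fun y => if h : y ∈ A then e ⟨f y, mem_image_of_mem f h⟩ else 0, fun n => ?_⟩
  have hfib : A ∩ (fun y => if h : y ∈ A then e ⟨f y, mem_image_of_mem f h⟩ else 0) ⁻¹' {n} =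
      A ∩ f ⁻¹' {(e.symm n).1} := by
    ext y
    refine and_congr_right fun hy => ?_
    simp only [mem_preimage, mem_singleton_iff, dif_pos hy]
    rw [← e.eq_symm_apply.trans Iff.rfl, Subtype.ext_iff]
  rw [hfib]
  refine ⟨(hperfect _).1, ?_, (hperfect _).2⟩
  obtain ⟨y, hy, hye⟩ := (e.symm n).2
  exact ⟨y, hy, hye⟩

/-- Every nonempty perfect zero-dimensional Polish space is a continuous bijective image of
Baire space. -/
theorem exists_continuous_bijective_nat_nat {α : Type*} [TopologicalSpace α] [PolishSpace α]
    [PerfectSpace α] [Nonempty α] (hz : IsZeroDimensional α) :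
    ∃ f : (ℕ → ℕ) → α, Continuous f ∧ Function.Bijective f := by
  let := upgradeIsCompletelyMetrizable α
  -- At `m = 0` the radius is `⊤`, so the first splitting has no size constraint.
  choose g hg using fun (A : {A : Set α // Perfect A ∧ A.Nonempty}) (m : ℕ) =>
    A.2.1.exists_small_partition hz A.2.2 (ε := (m : ENNReal)⁻¹) (by simp)
  let T : List ℕ → {A : Set α // Perfect A ∧ A.Nonempty} := fun l =>
    List.rec ⟨univ, PerfectSpace.univ_perfect α, univ_nonempty⟩
      (fun n l A => ⟨A.1 ∩ g A l.length ⁻¹' {n}, (hg A l.length n).1, (hg A l.length n).2.1⟩) l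
  let S : List ℕ → Set α := fun l => (T l).1
  have hS (n : ℕ) (l : List ℕ) : S (n :: l) = S l ∩ g (T l) l.length ⁻¹' {n} := rfl
  have hanti : CantorScheme.Antitone S := fun l n => hS n l ▸ inter_subset_left
  have hdisj : CantorScheme.Disjoint S := by
    intro l n m hnm
    refine disjoint_left.2 ?_
    rintro y ⟨-, hn⟩ ⟨-, hm⟩
    exact hnm (hn.symm.trans hm)
  have hdiam : CantorScheme.VanishingDiam S := by
    intro x
    rw [← tendsto_add_atTop_iff_nat 1]
    have hlim : Tendsto (fun n : ℕ => 2 * (n : ENNReal)⁻¹) atTop (𝓝 0) := by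
      simpa using ENNReal.Tendsto.const_mul ENNReal.tendsto_inv_nat_nhds_zero
        (Or.inr (by simp : (2 : ENNReal) ≠ ⊤))
    refine tendsto_of_tendsto_of_tendsto_of_le_of_le tendsto_const_nhds hlim
      (fun _ => zero_le) fun n => ?_
    obtain ⟨-, -, z, hz⟩ := hg (T (PiNat.res x n)) (PiNat.res x n).length (x n)
    rw [PiNat.res_length] at hz
    rw [PiNat.res_succ, hS, PiNat.res_length]
    exact (Metric.ediam_mono hz).trans Metric.ediam_eball_le
  have hdom : (CantorScheme.inducedMap S).1 = univ :=
    (hanti.closureAntitone fun l => (T l).2.1.closed).map_of_vanishingDiam hdiam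
      fun l => (T l).2.2
  let ι : (ℕ → ℕ) → (CantorScheme.inducedMap S).1 := fun x => ⟨x, hdom ▸ mem_univ x⟩
  refine ⟨fun x => (CantorScheme.inducedMap S).2 (ι x),
    hdiam.map_continuous.comp (continuous_id.subtype_mk _), ?_, fun y => ?_⟩
  · intro x x' h
    exact congrArg Subtype.val (hdisj.map_injective h)
  -- The branch through `y`: at each stage, append the index of the piece containing `y`.
  · let b : ℕ → List ℕ := fun n => Nat.rec [] (fun _ l => g (T l) l.length y :: l) n
    let x : ℕ → ℕ := fun n => g (T (b n)) (b n).length y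
    have hres (n : ℕ) : PiNat.res x n = b n := by
      induction n with
      | zero => rfl
      | succ n ih => rw [PiNat.res_succ, ih]
    have hmem (n : ℕ) : y ∈ S (b n) := by
      induction n with
      | zero => exact mem_univ y
      | succ n ih => exact ⟨ih, rfl⟩
    refine ⟨x, eq_of_forall_dist_le fun ε hε => ?_⟩
    obtain ⟨n, hn⟩ := hdiam.dist_lt ε hε x
    exact (hn _ (CantorScheme.map_mem (ι x) n) y (hres n ▸ hmem n)).le

/-- The uniquely universal property is inherited along a continuous bijection. -/
theorem IsUniquelyUniversal.preimage {Z Z' Y : Type*} [TopologicalSpace Z] [TopologicalSpace Z']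
    [TopologicalSpace Y] {U : Set (Z × Y)} (hU : IsUniquelyUniversal U) {f : Z' → Z}
    (hf : Continuous f) (hbij : Function.Bijective f) :
    IsUniquelyUniversal (Prod.map f id ⁻¹' U) := by
  refine ⟨hU.1.preimage (hf.prodMap continuous_id), fun W hW => ?_⟩
  obtain ⟨z, hz, huniq⟩ := hU.2 W hW
  obtain ⟨w, rfl⟩ := hbij.2 z
  exact ⟨w, hz, fun w' hw' => hbij.1 (huniq (f w') hw')⟩

/-! ### Existence of a coding basis -/

/-- A noncompact separable metric space has a coding basis. -/
theorem exists_isCodingBasis {X : Type*} [PseudoMetricSpace X] [SecondCountableTopology X]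
    (hX : ¬ CompactSpace X) : ∃ 𝓑 : Set (Set X), IsCodingBasis 𝓑 := by
  -- A sequence without cluster points; the basis consists of finite unions of basic sets that it
  -- visits finitely often.
  obtain ⟨u, hu⟩ : ∃ u : ℕ → X, ∀ a, ∃ s, IsOpen s ∧ a ∈ s ∧ {n | u n ∈ s}.Finite := by
    rw [compactSpace_iff_seqCompactSpace, ← isSeqCompact_univ_iff, IsSeqCompact] at hX
    push Not at hX
    obtain ⟨u, -, hu⟩ := hX
    refine ⟨u, fun a => ?_⟩
    have ha : ¬ MapClusterPt a atTop u := fun h => by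
      obtain ⟨φ, hφ, hlim⟩ := h.tendsto_subseq
      exact hu a (mem_univ a) φ hφ hlim
    rw [mapClusterPt_iff_frequently] at ha
    push Not at ha
    obtain ⟨s, hs, hfin⟩ := ha
    obtain ⟨t, hts, ht, hat⟩ := mem_nhds_iff.1 hs
    refine ⟨t, ht, hat, ?_⟩
    rw [← Nat.cofinite_eq_atTop, eventually_cofinite] at hfin
    exact hfin.subset fun n hn => not_not.2 (hts hn)
  let 𝓐 : Set (Set X) := {V ∈ countableBasis X | {n | u n ∈ V}.Finite}
  have hfin {S : Set (Set X)} (hS : S.Finite) (hSA : S ⊆ 𝓐) : {n | u n ∈ ⋃₀ S}.Finite := by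
    refine (hS.biUnion fun V hV => (hSA hV).2).subset fun n hn => ?_
    simpa using hn
  refine ⟨sUnion '' {S | S.Finite ∧ S ⊆ 𝓐}, ?_, ?_, ⟨∅, by simp, sUnion_empty⟩, ?_, ?_⟩
  · refine isTopologicalBasis_of_isOpen_of_nhds ?_ fun a O ha hO => ?_
    · rintro _ ⟨S, ⟨-, hS⟩, rfl⟩
      exact isOpen_sUnion fun V hV => isOpen_of_mem_countableBasis (hS hV).1
    · obtain ⟨s, hs, has, hsfin⟩ := hu a
      obtain ⟨V, hV, haV, hVs⟩ := (isBasis_countableBasis X).exists_subset_of_mem_open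
        (show a ∈ O ∩ s from ⟨ha, has⟩) (hO.inter hs)
      refine ⟨V, ⟨{V}, ⟨finite_singleton V, ?_⟩, sUnion_singleton V⟩, haV, fun y hy => (hVs hy).1⟩
      exact singleton_subset_iff.2 ⟨hV, hsfin.subset fun n hn => (hVs hn).2⟩
  · exact (countable_ofPred_finite_subset
      ((countable_countableBasis X).mono (sep_subset _ _))).image _
  · rintro _ ⟨S, ⟨hS, hSA⟩, rfl⟩ _ ⟨T, ⟨hT, hTA⟩, rfl⟩
    exact ⟨S ∪ T, ⟨hS.union hT, union_subset hSA hTA⟩, sUnion_union S T⟩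
  · rintro _ ⟨S, ⟨hS, hSA⟩, rfl⟩ hc
    -- The sequence takes each value finitely often, so a finite complement would account for only
    -- finitely many indices.
    have hcfin : {n | u n ∈ (⋃₀ S)ᶜ}.Finite := by
      refine (hc.biUnion fun a _ => ?_ : (⋃ a ∈ (⋃₀ S)ᶜ, {n | u n = a}).Finite).subset ?_
      · obtain ⟨s, -, has, hs⟩ := hu a
        refine hs.subset fun n hn => ?_
        rw [mem_ofPred_eq, show u n = a from hn]
        exact has
      · intro n hn
        exact mem_biUnion hn rfl
    refine infinite_univ (α := ℕ) (((hfin hS hSA).union hcfin).subset fun n _ => ?_)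
    exact em (u n ∈ ⋃₀ S)

/-! ### Good filters versus open sets -/

namespace Condition

variable {X : Type*} {𝓑 : Set (Set X)}

theorem countable_of_countable [Countable X] (h𝓑 : 𝓑.Countable) : Countable (Condition 𝓑) := by
  have := h𝓑.to_subtype
  refine Function.Injective.countable (f := fun p : Condition 𝓑 => ((⟨p.B, p.mem⟩ : 𝓑), p.F)) ?_
  intro p q h
  simp only [Prod.mk.injEq, Subtype.mk.injEq] at h
  exact Condition.ext h.1 h.2

/-- Two conditions without conflict have a common lower bound. -/
theorem exists_le_le (hun : ∀ B ∈ 𝓑, ∀ C ∈ 𝓑, B ∪ C ∈ 𝓑) (p q : Condition 𝓑)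
    (h₁ : Disjoint p.B (q.F : Set X)) (h₂ : Disjoint q.B (p.F : Set X)) :
    ∃ r : Condition 𝓑, r.B = p.B ∪ q.B ∧ (r.F : Set X) = (p.F : Set X) ∪ (q.F : Set X) ∧
      r ≤ p ∧ r ≤ q := by
  classical
  refine ⟨⟨p.B ∪ q.B, p.F ∪ q.F, hun _ p.mem _ q.mem, ?_⟩, rfl, Finset.coe_union _ _,
    ⟨subset_union_left, Finset.subset_union_left⟩, ⟨subset_union_right, Finset.subset_union_right⟩⟩
  rw [Finset.coe_union, disjoint_union_left, disjoint_union_right, disjoint_union_right]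
  exact ⟨⟨p.disj, h₁⟩, h₂, q.disj⟩

theorem incompatible_of_mem {p q : Condition 𝓑} {x : X} (hp : x ∈ p.B) (hq : x ∈ q.F) :
    p.Incompatible q := fun ⟨r, hrp, hrq⟩ =>
  disjoint_left.1 r.disj (hrp.1 hp) (Finset.mem_coe.2 (hrq.2 hq))

theorem Incompatible.symm {p q : Condition 𝓑} (h : p.Incompatible q) : q.Incompatible p :=
  fun ⟨r, hq, hp⟩ => h ⟨r, hp, hq⟩

end Condition

namespace IsCodingBasis

variable {X : Type*} [TopologicalSpace X] {𝓑 : Set (Set X)}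

/-- For (iii) and (iv) the witnesses are `(B, ∅)` with `B ⊆ U` around a point of `U`, and `(∅, {x})`
for a point `x` outside. -/
theorem isGoodFilter_codeSet (h𝓑 : IsCodingBasis 𝓑) {U : Set X} (hU : IsOpen U) :
    IsGoodFilter (codeSet 𝓑 U) where
  upward p q hpq hp := ⟨hpq.1.trans hp.1,
    subset_empty_iff.1 fun _ hx => hp.2.subset ⟨Finset.coe_subset.2 hpq.2 hx.1, hx.2⟩⟩
  directed p hp q hq := by
    obtain ⟨r, hB, hF, hrp, hrq⟩ := p.exists_le_le h𝓑.union_mem q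
      (disjoint_left.2 fun x hx hx' => hq.2.subset ⟨hx', hp.1 hx⟩)
      (disjoint_left.2 fun x hx hx' => hp.2.subset ⟨hx', hq.1 hx⟩)
    refine ⟨r, ⟨hB ▸ union_subset hp.1 hq.1, ?_⟩, hrp, hrq⟩
    rw [hF, union_inter_distrib_right, hp.2, hq.2, empty_union]
  decides x := by
    by_cases hx : x ∈ U
    · obtain ⟨B, hB, hxB, hBU⟩ := h𝓑.isBasis.exists_subset_of_mem_open hx hU
      exact ⟨⟨B, ∅, hB, by simp⟩, ⟨hBU, by simp⟩, Or.inl hxB⟩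
    · exact ⟨⟨∅, {x}, h𝓑.empty_mem, empty_disjoint _⟩, ⟨empty_subset _, by simpa using hx⟩,
        Or.inr (by simp)⟩
  mem_or_incompatible p := by
    by_cases hB : p.B ⊆ U
    · by_cases hF : (p.F : Set X) ∩ U = ∅
      · exact Or.inl ⟨hB, hF⟩
      · obtain ⟨x, hxF, hx⟩ := nonempty_iff_ne_empty.2 hF
        obtain ⟨B, hB, hxB, hBU⟩ := h𝓑.isBasis.exists_subset_of_mem_open hx hU
        exact Or.inr ⟨⟨B, ∅, hB, by simp⟩, ⟨hBU, by simp⟩,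
          (Condition.incompatible_of_mem hxB hxF).symm⟩
    · obtain ⟨x, hxB, hx⟩ := not_subset.1 hB
      exact Or.inr ⟨⟨∅, {x}, h𝓑.empty_mem, empty_disjoint _⟩, ⟨empty_subset _, by simpa using hx⟩,
        Condition.incompatible_of_mem hxB (Finset.mem_singleton_self x)⟩

theorem isOpen_openSet (h𝓑 : IsCodingBasis 𝓑) (G : GoodFilter 𝓑) : IsOpen G.openSet :=
  isOpen_biUnion fun p _ => h𝓑.isBasis.isOpen p.mem

theorem openSet_codeSet (h𝓑 : IsCodingBasis 𝓑) {U : Set X} (hU : IsOpen U) :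
    GoodFilter.openSet ⟨codeSet 𝓑 U, h𝓑.isGoodFilter_codeSet hU⟩ = U := by
  refine Subset.antisymm (iUnion₂_subset fun p hp => hp.1) fun x hx => ?_
  obtain ⟨B, hB, hxB, hBU⟩ := h𝓑.isBasis.exists_subset_of_mem_open hx hU
  exact mem_biUnion (x := (⟨B, ∅, hB, by simp⟩ : Condition 𝓑)) ⟨hBU, by simp⟩ hxB

/-- Directedness keeps each `B` of the filter disjoint from each `F`. Hence a condition that agrees
with the union has no conflict with any member, closure under unions makes it compatible with all of
them, and (iv) puts it in `G`. -/
theorem codeSet_openSet (h𝓑 : IsCodingBasis 𝓑) (G : GoodFilter 𝓑) :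
    codeSet 𝓑 G.openSet = G.1 := by
  have hdisj {p q : Condition 𝓑} (hp : p ∈ G.1) (hq : q ∈ G.1) : Disjoint p.B (q.F : Set X) :=
    disjoint_left.2 fun x hxp hxq => by
      obtain ⟨r, -, hrp, hrq⟩ := G.2.directed p hp q hq
      exact Condition.incompatible_of_mem hxp hxq ⟨r, hrp, hrq⟩
  refine Subset.antisymm (fun p hp => ?_) fun p hp => ⟨subset_biUnion_of_mem (u := Condition.B) hp,
    ?_⟩
  · refine (G.2.mem_or_incompatible p).resolve_right ?_
    rintro ⟨q, hq, hpq⟩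
    obtain ⟨r, -, -, hr⟩ := p.exists_le_le h𝓑.union_mem q
      (disjoint_left.2 fun x hxp hxq => by
        obtain ⟨s, hs, hxs⟩ := mem_iUnion₂.1 (hp.1 hxp)
        exact disjoint_left.1 (hdisj hs hq) hxs hxq)
      (disjoint_left.2 fun x hxq hxp => hp.2.subset ⟨hxp, mem_biUnion hq hxq⟩)
    exact hpq ⟨r, hr⟩
  · refine subset_empty_iff.1 ?_
    rintro x ⟨hxF, hx⟩
    obtain ⟨s, hs, hxs⟩ := mem_iUnion₂.1 hx
    exact disjoint_left.1 (hdisj hs hp) hxs hxF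

end IsCodingBasis

/-! ### Topology of the space of good filters -/

namespace GoodFilter

variable {X : Type*} {𝓑 : Set (Set X)}

theorem char_eq_true_iff (G : GoodFilter 𝓑) (p : Condition 𝓑) : G.char p = true ↔ p ∈ G.1 := by
  simp [char]

theorem isEmbedding_char : IsEmbedding (char : GoodFilter 𝓑 → Condition 𝓑 → Bool) := by
  refine ⟨⟨rfl⟩, fun G H h => Subtype.ext (Set.ext fun p => ?_)⟩
  rw [← char_eq_true_iff, h, char_eq_true_iff]

theorem isClopen_mem (p : Condition 𝓑) : IsClopen {G : GoodFilter 𝓑 | p ∈ G.1} := by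
  have h : IsClopen ((fun G : GoodFilter 𝓑 => G.char p) ⁻¹' {true}) :=
    (isClopen_discrete _).preimage ((continuous_apply p).comp isEmbedding_char.continuous)
  convert h using 1
  ext G
  exact (char_eq_true_iff G p).symm

theorem isGδ_range_char [Countable X] [Countable (Condition 𝓑)] :
    IsGδ (range (char : GoodFilter 𝓑 → Condition 𝓑 → Bool)) := by
  let E : Condition 𝓑 → Set (Condition 𝓑 → Bool) := fun p => {c | c p = true}
  have hE (p : Condition 𝓑) : IsClopen (E p) :=
    (isClopen_discrete {true}).preimage (continuous_apply p)
  have hr : range (char : GoodFilter 𝓑 → Condition 𝓑 → Bool) =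
      (⋂ (p) (q) (_ : p ≤ q), ((E p)ᶜ ∪ E q)) ∩
      (⋂ (p) (q), ((E p)ᶜ ∪ ((E q)ᶜ ∪ ⋃ (r) (_ : r ≤ p ∧ r ≤ q), E r))) ∩
      (⋂ x : X, ⋃ (p : Condition 𝓑) (_ : x ∈ p.B ∪ (p.F : Set X)), E p) ∩
      ⋂ p : Condition 𝓑, (E p ∪ ⋃ (q) (_ : p.Incompatible q), E q) := by
    ext c
    have hc : c ∈ range (char : GoodFilter 𝓑 → Condition 𝓑 → Bool) ↔
        IsGoodFilter {p | c p = true} := by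
      constructor
      · rintro ⟨G, rfl⟩
        simp only [char_eq_true_iff]
        exact G.2
      · intro h
        refine ⟨⟨_, h⟩, funext fun p => ?_⟩
        simp [char]
    rw [hc]
    simp only [mem_inter_iff, mem_iInter, mem_union, mem_compl_iff, mem_iUnion, exists_prop,
      ← imp_iff_not_or, E, mem_ofPred_eq]
    constructor
    · rintro ⟨h₁, h₂, h₃, h₄⟩
      refine ⟨⟨⟨h₁, fun p q hp hq => ?_⟩, fun x => ?_⟩, fun p => ?_⟩
      · obtain ⟨r, hr, h⟩ := h₂ p hp q hq
        exact ⟨r, h, hr⟩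
      · obtain ⟨p, hp, h⟩ := h₃ x
        exact ⟨p, h, hp⟩
      · exact (h₄ p).imp_right fun ⟨q, hq, h⟩ => ⟨q, h, hq⟩
    · rintro ⟨⟨⟨h₁, h₂⟩, h₃⟩, h₄⟩
      refine ⟨h₁, fun p hp q hq => ?_, fun x => ?_, fun p => ?_⟩
      · obtain ⟨r, hr, h⟩ := h₂ p q hp hq
        exact ⟨r, h, hr⟩
      · obtain ⟨p, hp, h⟩ := h₃ x
        exact ⟨p, h, hp⟩
      · exact (h₄ p).imp_right fun ⟨q, hq, h⟩ => ⟨q, h, hq⟩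
  rw [hr]
  refine (((IsGδ.iInter fun p => .iInter fun q => .iInter fun _ => ?_).inter
    (.iInter fun p => .iInter fun q => ?_)).inter (.iInter fun x => ?_)).inter (.iInter fun p => ?_)
  · exact ((hE p).compl.isOpen.union (hE q).isOpen).isGδ
  · exact ((hE p).compl.isOpen.union ((hE q).compl.isOpen.union
      (isOpen_biUnion fun r _ => (hE r).isOpen))).isGδ
  · exact (isOpen_biUnion fun p _ => (hE p).isOpen).isGδ
  · exact ((hE p).isOpen.union (isOpen_biUnion fun q _ => (hE q).isOpen)).isGδ

theorem polishSpace [Countable X] [Countable (Condition 𝓑)] : PolishSpace (GoodFilter 𝓑) :=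
  have : PolishSpace Bool :=
    (IsClosedEmbedding.of_continuous_injective_isClosedMap continuous_of_discreteTopology
      (Encodable.encode_injective (α := Bool)) fun _ _ => isClosed_discrete _).polishSpace
  isEmbedding_char.polishSpace_of_isGδ_range isGδ_range_char

/-- Every neighbourhood of a good filter contains all good filters through one of its members. -/
theorem exists_mem_forall_of_mem_nhds {G : GoodFilter 𝓑} [Nonempty X] {s : Set (GoodFilter 𝓑)}
    (hs : s ∈ 𝓝 G) : ∃ p ∈ G.1, ∀ H : GoodFilter 𝓑, p ∈ H.1 → H ∈ s := by
  rw [isEmbedding_char.isInducing.nhds_eq_comap, nhds_pi, mem_comap] at hs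
  obtain ⟨t, ht, hts⟩ := hs
  obtain ⟨I, hI, V, hV, hVt⟩ := Filter.mem_pi.1 ht
  -- A single member of `G` decides membership of `q`: `q` itself, or a member incompatible with
  -- `q`.
  have hlower (q : Condition 𝓑) : ∃ p ∈ G.1, ∀ H : GoodFilter 𝓑, p ∈ H.1 → H.char q = G.char q := by
    rcases G.2.mem_or_incompatible q with hq | ⟨p, hp, hpq⟩
    · refine ⟨q, hq, fun H hH => ?_⟩
      rw [(char_eq_true_iff H q).2 hH, (char_eq_true_iff G q).2 hq]
    · refine ⟨p, hp, fun H hH => ?_⟩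
      have hnot {K : GoodFilter 𝓑} (hK : p ∈ K.1) : K.char q = false := by
        rw [← Bool.not_eq_true, char_eq_true_iff]
        intro hqK
        obtain ⟨r, -, hr⟩ := K.2.directed q hqK p hK
        exact hpq ⟨r, hr⟩
      rw [hnot hH, hnot hp]
  choose l hlG hl using hlower
  have hbound : ∃ p ∈ G.1, ∀ q ∈ I, p ≤ l q := by
    clear hVt
    induction I, hI using Set.Finite.induction_on with
    | empty =>
      -- Axiom (iii) at any point shows that `G` is nonempty.
      obtain ⟨p, hp, -⟩ := G.2.decides (Classical.arbitrary X)
      exact ⟨p, hp, by simp⟩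
    | @insert a I _ _ ih =>
      obtain ⟨p, hp, hpI⟩ := ih
      obtain ⟨r, hr, hrp, hra⟩ := G.2.directed p hp (l a) (hlG a)
      refine ⟨r, hr, fun q hq => ?_⟩
      rcases hq with rfl | hq
      · exact hra
      · exact hrp.trans (hpI q hq)
  obtain ⟨p, hp, hpI⟩ := hbound
  refine ⟨p, hp, fun H hH => hts (hVt fun q hq => ?_)⟩
  rw [hl q H (H.2.upward p _ (hpI q hq) hH)]
  exact mem_of_mem_nhds (hV q)

theorem isZeroDimensional [Nonempty X] : IsZeroDimensional (GoodFilter 𝓑) := by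
  refine isTopologicalBasis_of_isOpen_of_nhds (fun s hs => hs.isOpen) fun G s hG hs => ?_
  obtain ⟨p, hp, hps⟩ := exists_mem_forall_of_mem_nhds (hs.mem_nhds hG)
  exact ⟨_, isClopen_mem p, hp, hps⟩

end GoodFilter

/-! ### The universal set, and absence of isolated points -/

namespace IsCodingBasis

variable {X : Type*} [TopologicalSpace X] {𝓑 : Set (Set X)}

theorem isUniquelyUniversal (h𝓑 : IsCodingBasis 𝓑) :
    IsUniquelyUniversal {z : GoodFilter 𝓑 × X | ∃ p ∈ z.1.1, z.2 ∈ p.B} := by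
  have hsec (G : GoodFilter 𝓑) :
      {x : X | (G, x) ∈ {z : GoodFilter 𝓑 × X | ∃ p ∈ z.1.1, z.2 ∈ p.B}} = G.openSet := by
    ext x
    simp [GoodFilter.openSet]
  constructor
  · have : {z : GoodFilter 𝓑 × X | ∃ p ∈ z.1.1, z.2 ∈ p.B} =
        ⋃ p : Condition 𝓑, {G : GoodFilter 𝓑 | p ∈ G.1} ×ˢ p.B := by
      ext z
      simp
    rw [this]
    exact isOpen_iUnion fun p =>
      (GoodFilter.isClopen_mem p).isOpen.prod (h𝓑.isBasis.isOpen p.mem)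
  · intro W hW
    refine ⟨⟨codeSet 𝓑 W, h𝓑.isGoodFilter_codeSet hW⟩, ?_, fun G hG => Subtype.ext ?_⟩
    · exact (hsec _).trans (h𝓑.openSet_codeSet hW)
    · have hGW : G.openSet = W := (hsec G).symm.trans hG
      exact (h𝓑.codeSet_openSet G).symm.trans (congrArg (codeSet 𝓑) hGW)

/-- The open sets `p.B` and the complement of `p.F` both obey `p`, and they differ since the
complement of `p.B` is infinite while `p.F` is finite. At least one of their codes is therefore not
`G`. -/
theorem perfectSpace [T1Space X] [Nonempty X] (h𝓑 : IsCodingBasis 𝓑) :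
    PerfectSpace (GoodFilter 𝓑) := by
  refine ⟨preperfect_iff_nhds.2 fun G _ s hs => ?_⟩
  obtain ⟨p, -, hps⟩ := GoodFilter.exists_mem_forall_of_mem_nhds hs
  have hmem {U : Set X} (hU : IsOpen U) (hBU : p.B ⊆ U) (hUF : U ⊆ (p.F : Set X)ᶜ) :
      (⟨codeSet 𝓑 U, h𝓑.isGoodFilter_codeSet hU⟩ : GoodFilter 𝓑) ∈ s :=
    hps _ ⟨hBU, disjoint_iff_inter_eq_empty.1 (disjoint_left.2 fun _ hx hxU => hUF hxU hx)⟩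
  have hB : IsOpen p.B := h𝓑.isBasis.isOpen p.mem
  have hF : IsOpen (p.F : Set X)ᶜ := p.F.finite_toSet.isClosed.isOpen_compl
  have hBF : p.B ⊆ (p.F : Set X)ᶜ := subset_compl_iff_disjoint_right.2 p.disj
  by_cases hG : (⟨codeSet 𝓑 p.B, h𝓑.isGoodFilter_codeSet hB⟩ : GoodFilter 𝓑) = G
  · refine ⟨⟨_, h𝓑.isGoodFilter_codeSet hF⟩, ⟨hmem hF hBF subset_rfl, mem_univ _⟩, fun h => ?_⟩
    obtain ⟨x, hxB, hxF⟩ := (h𝓑.infinite_compl p.B p.mem).exists_notMem_finset p.F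
    have := congrArg GoodFilter.openSet (h.trans hG.symm)
    rw [h𝓑.openSet_codeSet hF, h𝓑.openSet_codeSet hB] at this
    exact hxB (this.subset hxF)
  · exact ⟨_, ⟨hmem hB subset_rfl hBF, mem_univ _⟩, hG⟩

end IsCodingBasis

/-- The product of Baire space with a noncompact countable metric space is uniquely universal. -/
theorem uu_nat_nat_of_countable_of_not_compactSpace {X : Type*} [MetricSpace X] [Countable X]
    (hX : ¬ CompactSpace X) : UU (ℕ → ℕ) X := by
  have : Nonempty X := not_isEmpty_iff.1 fun _ => hX inferInstance
  obtain ⟨𝓑, h𝓑⟩ := exists_isCodingBasis hX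
  have := Condition.countable_of_countable h𝓑.countable
  have := GoodFilter.polishSpace (𝓑 := 𝓑)
  have := h𝓑.perfectSpace
  have : Nonempty (GoodFilter 𝓑) := ⟨⟨_, h𝓑.isGoodFilter_codeSet isOpen_empty⟩⟩
  obtain ⟨f, hf, hbij⟩ := exists_continuous_bijective_nat_nat
    (GoodFilter.isZeroDimensional (𝓑 := 𝓑))
  exact ⟨_, h𝓑.isUniquelyUniversal.preimage hf hbij⟩

theorem mainTheorem5 :
    (∀ (X : Type*) [MetricSpace X] [Countable X], ¬ CompactSpace X →
      UU (ℕ → ℕ) X ∧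
      (∃ 𝓑 : Set (Set X), IsCodingBasis 𝓑) ∧
      (∀ 𝓑 : Set (Set X), IsCodingBasis 𝓑 →
        Countable (Condition 𝓑) ∧
        (∀ G : GoodFilter 𝓑, IsOpen G.openSet ∧ codeSet 𝓑 G.openSet = G.1) ∧
        (∀ U : Set X, IsOpen U → ∃ h : IsGoodFilter (codeSet 𝓑 U),
          GoodFilter.openSet ⟨codeSet 𝓑 U, h⟩ = U) ∧
        IsUniquelyUniversal {z : GoodFilter 𝓑 × X | ∃ p ∈ z.1.1, z.2 ∈ p.B} ∧
        PolishSpace (GoodFilter 𝓑) ∧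
        IsZeroDimensional (GoodFilter 𝓑) ∧
        PerfectSpace (GoodFilter 𝓑))) ∧
    UU (ℕ → ℕ) ℚ := by
  refine ⟨fun X _ _ hX => ⟨uu_nat_nat_of_countable_of_not_compactSpace hX,
    exists_isCodingBasis hX, fun 𝓑 h𝓑 => ?_⟩,
    uu_nat_nat_of_countable_of_not_compactSpace (not_compactSpace_iff.2 inferInstance)⟩
  have : Nonempty X := not_isEmpty_iff.1 fun _ => hX inferInstance
  have := Condition.countable_of_countable h𝓑.countable
  exact ⟨this, fun G => ⟨h𝓑.isOpen_openSet G, h𝓑.codeSet_openSet G⟩,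
    fun U hU => ⟨h𝓑.isGoodFilter_codeSet hU, h𝓑.openSet_codeSet hU⟩, h𝓑.isUniquelyUniversal,
    GoodFilter.polishSpace, GoodFilter.isZeroDimensional, h𝓑.perfectSpace⟩
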